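/- Let $D\subset\mathbb C$ be a bounded domain (open connected set) containing $0$ whose boundary $\partial D$ is a Jordan curve, with $\operatorname{dist}(0,\partial D)=1$. For an integer $N\ge 1$ and $x\in\frac1N\mathbb Z^2$ let $S_N(x)=x+[-\tfrac1{2N},\tfrac1{2N}]^2$. Let $D''_N=\{x\in\frac1N\mathbb Z^2 : S_N(x)\subset D\}$ and let $D'_N$ be the connected component of $D''_N$ containing $0$ (for nearest-neighbour adjacency). Let $\partial_i D'_N$ be the set of points of $D'_N$ having a nearest neighbour in $\frac1N\mathbb Z^2\setminus D'_N$, let $D_N$ be the connected component containing $0$ of $D'_N\setminus\partial_i D'_N$ (empty if $0\in\partial_iD'_N$, which can happen only for $N=1$), and let $\tilde D_N$ be the interior of $\bigcup_{x\in D_N}S_N(x)$. For subsets $U_n$ of $\mathbb C$, the kernel of $(U_n)$ is the largest domain containing $0$ each compact subset of which is contained in all but finitely many $U_n$, and $U_n\to U$ in the Carathéodory sense means that every subsequence of $(U_n)$ has kernel $U$. A normalized Riemann map onto $U$ is an injective holomorphic map $g$ of the unit disk $\mathbb D$ onto $U$ with $g(0)=0$ and $g'(0)>0$. Then: 1. $\tilde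 D_N\to D$ in the Carathéodory sense as $N\to\infty$. 2. If $f$ is the normalized Riemann map onto $D$ and, for each $N$ in a set $S$ of positive integers (for example $S=\{N\ge 2\}$), $f_N$ is the normalized Riemann map onto $\tilde D_N$, then $f_N\to f$ uniformly on every compact subset of $\mathbb D$ as $N\to\infty$ in $S$. Both assertions also hold if $D_N$ is replaced by the whole of $D'_N\setminus\partial_iD'_N$ in the definition of $\tilde D_N$ (in 2., for sets $S$ of those $N$ for which a normalized Riemann map onto the resulting set exists). -/

import Mathlib

open Set Filter Topology

/-- A Jordan domain: a bounded open connected subset of the plane whose boundary is homeomorphic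
to a circle. -/
structure IsJordanDomain (D : Set ℂ) : Prop where
  isOpen : IsOpen D
  isConnected : IsConnected D
  isBounded : Bornology.IsBounded D
  jordan : Nonempty (Circle ≃ₜ frontier D)

/-- `f` restricts to a conformal transformation of the open unit disk onto `U` with `f 0 = 0` and
with `f' 0` real and positive. -/
structure IsNormalizedRiemannMap (f : ℂ → ℂ) (U : Set ℂ) : Prop where
  differentiableOn : DifferentiableOn ℂ f (Metric.ball 0 1)
  injOn : InjOn f (Metric.ball 0 1)
  image_eq : f '' Metric.ball 0 1 = U
  map_zero : f 0 = 0
  deriv_re_pos : 0 < (deriv f 0).re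
  deriv_im_eq_zero : (deriv f 0).im = 0

/-! ### Lattice sets

A point `(a, b)` of `ℤ × ℤ` stands for the point `(a + b i) / N` of the lattice `(1/N) ℤ²`. -/

/-- Nearest neighbours in the square lattice. -/
def LatticeAdj (x y : ℤ × ℤ) : Prop := |x.1 - y.1| + |x.2 - y.2| = 1

/-- The connected component of `A` containing the origin (empty if the origin is not in `A`). -/
def originComponent (A : Set (ℤ × ℤ)) : Set (ℤ × ℤ) :=
  {x | 0 ∈ A ∧ Relation.ReflTransGen (fun u v => v ∈ A ∧ LatticeAdj u v) 0 x}

/-- The inner boundary: the points of `A` with a nearest neighbour outside `A`. -/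
def innerBoundary (A : Set (ℤ × ℤ)) : Set (ℤ × ℤ) :=
  {x | x ∈ A ∧ ∃ y, y ∉ A ∧ LatticeAdj x y}

/-- The closed square of side `1/N` centred at `(a + b i) / N`, with sides parallel to the axes. -/
def scaledSquare (N : ℕ) (x : ℤ × ℤ) : Set ℂ :=
  {z | |z.re - (x.1 : ℝ) / N| ≤ 1 / (2 * N) ∧ |z.im - (x.2 : ℝ) / N| ≤ 1 / (2 * N)}

/-- The lattice points whose square lies in `D` (such a point lies in `D` itself). -/
def squaresInside (D : Set ℂ) (N : ℕ) : Set (ℤ × ℤ) :=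
  {x | scaledSquare N x ⊆ D}

/-- The component of the origin in `squaresInside D N`, with its inner boundary removed. -/
def erodedApprox (D : Set ℂ) (N : ℕ) : Set (ℤ × ℤ) :=
  originComponent (squaresInside D N) \ innerBoundary (originComponent (squaresInside D N))

/-- The `1/N`-scale discrete approximation of `D`: the part of `erodedApprox D N` connected to the
origin. It is all of `erodedApprox D N` exactly when the latter is connected (and contains the
origin) or empty. -/
def discreteApprox (D : Set ℂ) (N : ℕ) : Set (ℤ × ℤ) :=
  originComponent (erodedApprox D N)

/-- The interior of the union of the scaled squares centred at the points of `A`. -/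
def unionOfSquares (N : ℕ) (A : Set (ℤ × ℤ)) : Set ℂ :=
  interior (⋃ x ∈ A, scaledSquare N x)

/-! ### Kernels and Carathéodory convergence -/

/-- `D` is the kernel of the sequence `U`: the largest domain containing the origin each compact
subset of which lies in all but finitely many of the `U n`. -/
def IsKernel (U : ℕ → Set ℂ) (D : Set ℂ) : Prop :=
  IsGreatest {E : Set ℂ | IsOpen E ∧ IsConnected E ∧ 0 ∈ E ∧
    ∀ K : Set ℂ, IsCompact K → K ⊆ E → ∀ᶠ n in atTop, K ⊆ U n} D

/-- Carathéodory convergence: every subsequence has kernel `D`. -/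
def CaratheodoryConverges (U : ℕ → Set ℂ) (D : Set ℂ) : Prop :=
  ∀ φ : ℕ → ℕ, StrictMono φ → IsKernel (fun n => U (φ n)) D

/-! All approximating sets lie in `D`, so everything reduces to showing that a compact `K ⊆ D` is
eventually covered (`eventually_subset_unionOfSquares_discreteApprox`). Enlarge `K` to a compact
connected set through `0`: for large `N`, all lattice boxes of a fixed size around it have their
squares in `D`, and connectedness carries them into the component of the origin. The Riemann maps
then converge by a quantitative Schwarz lemma, without normal families: `F N = f ∘ ω` with `ω` a
self-map of the disk (`exists_lift`), covering `f '' closedBall 0 (1 - η)` forces `ω' 0` to be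
within `η` of `1`, and Borel–Carathéodory makes `ω` close to the identity. -/

/-! ### Lattice approximation -/

/-- The lattice square of side `2 k + 1` centred at `x`. -/
def latticeBox (k : ℕ) (x : ℤ × ℤ) : Set (ℤ × ℤ) :=
  {y | (y.1 - x.1).natAbs ≤ k ∧ (y.2 - x.2).natAbs ≤ k}

/-- The lattice point whose scaled square contains `z`. -/
noncomputable def latticeRound (N : ℕ) (z : ℂ) : ℤ × ℤ :=
  (round ((N : ℝ) * z.re), round ((N : ℝ) * z.im))

theorem self_mem_latticeBox (k : ℕ) (x : ℤ × ℤ) : x ∈ latticeBox k x := by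
  simp [latticeBox]

theorem originComponent_subset (A : Set (ℤ × ℤ)) : originComponent A ⊆ A := by
  rintro x ⟨h0, hx⟩
  rcases Relation.ReflTransGen.cases_tail hx with rfl | ⟨_, _, h, _⟩
  · exact h0
  · exact h

theorem mem_originComponent_of_latticeAdj {A : Set (ℤ × ℤ)} {x y : ℤ × ℤ}
    (hx : x ∈ originComponent A) (hy : y ∈ A) (h : LatticeAdj x y) : y ∈ originComponent A :=
  ⟨hx.1, hx.2.tail ⟨hy, h⟩⟩

/-- Induction on the ℓ¹ distance to the centre: a unit step towards the centre stays in the box. -/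
theorem latticeBox_subset_originComponent {A : Set (ℤ × ℤ)} {k : ℕ} {x : ℤ × ℤ}
    (hA : latticeBox k x ⊆ A) (hx : x ∈ originComponent A) :
    latticeBox k x ⊆ originComponent A := by
  suffices H : ∀ (n : ℕ) (y : ℤ × ℤ), (y.1 - x.1).natAbs + (y.2 - x.2).natAbs = n →
      y ∈ latticeBox k x → y ∈ originComponent A from fun y hy => H _ y rfl hy
  intro n
  induction n with
  | zero =>
    intro y hn _
    have : y = x := Prod.ext (by omega) (by omega)
    rwa [this]
  | succ n ih =>
    rintro ⟨a, b⟩ hn ⟨h1, h2⟩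
    have step (a' b' : ℤ) (hadj : |a' - a| + |b' - b| = 1)
        (hn' : (a' - x.1).natAbs + (b' - x.2).natAbs = n)
        (h1' : (a' - x.1).natAbs ≤ k) (h2' : (b' - x.2).natAbs ≤ k) :
        (a, b) ∈ originComponent A :=
      mem_originComponent_of_latticeAdj (ih (a', b') hn' ⟨h1', h2'⟩) (hA ⟨h1, h2⟩) hadj
    simp only at hn h1 h2
    rcases lt_trichotomy a x.1 with h | h | h
    · exact step (a + 1) b (by simp) (by omega) (by omega) h2
    · rcases lt_trichotomy b x.2 with h' | h' | h'
      · exact step a (b + 1) (by simp) (by omega) h1 (by omega)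
      · omega
      · exact step a (b - 1) (by simp) (by omega) h1 (by omega)
    · exact step (a - 1) b (by simp) (by omega) (by omega) h2

theorem latticeBox_subset_diff_innerBoundary {A : Set (ℤ × ℤ)} {k : ℕ} {x : ℤ × ℤ}
    (hA : latticeBox (k + 1) x ⊆ A) : latticeBox k x ⊆ A \ innerBoundary A := by
  rintro y ⟨h1, h2⟩
  refine ⟨hA ⟨by omega, by omega⟩, ?_⟩
  rintro ⟨-, w, hw, hadj⟩
  rw [LatticeAdj, Int.abs_eq_natAbs, Int.abs_eq_natAbs] at hadj
  exact hw (hA ⟨by omega, by omega⟩)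

theorem abs_sub_round_div_le {N : ℕ} (hN : 0 < N) (t : ℝ) :
    |t - (round ((N : ℝ) * t) : ℝ) / N| ≤ 1 / (2 * N) := by
  have hN' : (0 : ℝ) < N := by exact_mod_cast hN
  have h := abs_sub_round ((N : ℝ) * t)
  have e : t - (round ((N : ℝ) * t) : ℝ) / N = ((N : ℝ) * t - round ((N : ℝ) * t)) / N := by
    field_simp
  rw [e, abs_div, abs_of_pos hN', div_le_div_iff₀ hN' (by positivity)]
  nlinarith

theorem mem_scaledSquare_latticeRound {N : ℕ} (hN : 0 < N) (z : ℂ) :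
    z ∈ scaledSquare N (latticeRound N z) :=
  ⟨abs_sub_round_div_le hN _, abs_sub_round_div_le hN _⟩

theorem natAbs_round_sub_round_le {N : ℕ} (hN : 0 < N) {s t : ℝ} (h : |s - t| < 1 / (2 * N)) :
    (round ((N : ℝ) * s) - round ((N : ℝ) * t)).natAbs ≤ 1 := by
  have hN' : (0 : ℝ) < N := by exact_mod_cast hN
  have h1 := abs_le.1 (abs_sub_round ((N : ℝ) * s))
  have h2 := abs_le.1 (abs_sub_round ((N : ℝ) * t))
  have h3 : |(N : ℝ) * s - N * t| < 1 / 2 := by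
    rw [← mul_sub, abs_mul, abs_of_pos hN']
    calc (N : ℝ) * |s - t| < N * (1 / (2 * N)) := by gcongr
      _ = 1 / 2 := by field_simp
  have h4 := abs_lt.1 h3
  have h5 : (round ((N : ℝ) * s) - round ((N : ℝ) * t) : ℤ) < 2 := by
    have : ((round ((N : ℝ) * s) - round ((N : ℝ) * t) : ℤ) : ℝ) < 2 := by
      push_cast; linarith
    exact_mod_cast this
  have h6 : -2 < (round ((N : ℝ) * s) - round ((N : ℝ) * t) : ℤ) := by
    have : (-2 : ℝ) < ((round ((N : ℝ) * s) - round ((N : ℝ) * t) : ℤ) : ℝ) := by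
      push_cast; linarith
    exact_mod_cast this
  omega

theorem latticeRound_mem_latticeBox {N : ℕ} (hN : 0 < N) {z w : ℂ}
    (h : dist w z < 1 / (2 * N)) : latticeRound N w ∈ latticeBox 1 (latticeRound N z) := by
  rw [Complex.dist_eq] at h
  refine ⟨natAbs_round_sub_round_le hN (lt_of_le_of_lt ?_ h),
    natAbs_round_sub_round_le hN (lt_of_le_of_lt ?_ h)⟩
  · simpa using Complex.abs_re_le_norm (w - z)
  · simpa using Complex.abs_im_le_norm (w - z)

theorem latticeRound_zero (N : ℕ) : latticeRound N 0 = 0 := by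
  simp [latticeRound]

theorem latticeBox_mono {k l : ℕ} (h : k ≤ l) (x : ℤ × ℤ) : latticeBox k x ⊆ latticeBox l x :=
  fun _ hy => ⟨hy.1.trans h, hy.2.trans h⟩

/-- If the boxes around the roundings of a connected set containing the origin lie in `A`, then
they lie in the component of the origin in `A`. -/
theorem latticeBox_latticeRound_subset_originComponent {K : Set ℂ} (hK : IsPreconnected K)
    (h0 : (0 : ℂ) ∈ K) {N : ℕ} (hN : 0 < N) {k : ℕ} (hk : 1 ≤ k) {A : Set (ℤ × ℤ)}
    (hA : ∀ z ∈ K, latticeBox k (latticeRound N z) ⊆ A) :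
    ∀ z ∈ K, latticeBox k (latticeRound N z) ⊆ originComponent A := by
  have h0A : (0 : ℤ × ℤ) ∈ A := by
    have := hA 0 h0 (self_mem_latticeBox _ _)
    rwa [latticeRound_zero] at this
  have hpos : (0 : ℝ) < 1 / (2 * N) := by positivity
  have near (z w : ℂ) (hz : z ∈ K) (hzw : dist w z < 1 / (2 * N))
      (h : latticeRound N z ∈ originComponent A) : latticeRound N w ∈ originComponent A :=
    latticeBox_subset_originComponent (hA z hz) h
      (latticeBox_mono hk _ (latticeRound_mem_latticeBox hN hzw))
  intro z hz
  refine latticeBox_subset_originComponent (hA z hz) ?_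
  -- This relation is transitive and holds both ways between nearby points, so it holds across a
  -- preconnected set.
  refine hK.induction₂'
    (fun z w => latticeRound N z ∈ originComponent A → latticeRound N w ∈ originComponent A)
    ?_ (fun _ _ _ _ _ _ h h' => h' ∘ h) h0 hz ?_
  · intro z hz
    filter_upwards [self_mem_nhdsWithin, mem_nhdsWithin_of_mem_nhds (Metric.ball_mem_nhds z hpos)]
      with w hw hwz
    exact ⟨near z w hz hwz, near w z hw (by rwa [dist_comm])⟩
  · rw [latticeRound_zero]
    exact ⟨h0A, .refl⟩

/-- Each coordinate contributes `1/(2N)` from the square, `k/N` from the box and `1/(2N)` from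
rounding; the factor 2 adds the two coordinates. -/
theorem dist_le_of_mem_scaledSquare {N : ℕ} (hN : 0 < N) {k : ℕ} {z p : ℂ} {y : ℤ × ℤ}
    (hy : y ∈ latticeBox k (latticeRound N z)) (hp : p ∈ scaledSquare N y) :
    dist p z ≤ 2 * (k + 1) / N := by
  have hN' : (0 : ℝ) < N := by exact_mod_cast hN
  have aux (s t : ℝ) (m : ℤ) (hm : (m - round ((N : ℝ) * t)).natAbs ≤ k)
      (hs : |s - (m : ℝ) / N| ≤ 1 / (2 * N)) : |s - t| ≤ (k + 1) / N := by
    have h1 := abs_sub_round_div_le hN t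
    have h2 : |((m : ℝ) - round ((N : ℝ) * t))| ≤ k := by
      have : |m - round ((N : ℝ) * t)| ≤ (k : ℤ) := by
        rw [Int.abs_eq_natAbs]; exact_mod_cast hm
      exact_mod_cast this
    have h3 : |(m : ℝ) / N - (round ((N : ℝ) * t) : ℝ) / N| ≤ k / N := by
      rw [← sub_div, abs_div, abs_of_pos hN']
      gcongr
    have e : (k + 1 : ℝ) / N = 1 / (2 * N) + k / N + 1 / (2 * N) := by field_simp; ring
    rw [e]
    rw [abs_le] at *
    constructor <;> linarith
  have h1 := aux p.re z.re y.1 hy.1 hp.1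
  have h2 := aux p.im z.im y.2 hy.2 hp.2
  have h3 := Complex.norm_le_abs_re_add_abs_im (p - z)
  rw [Complex.sub_re, Complex.sub_im] at h3
  have e : 2 * (k + 1 : ℝ) / N = (k + 1) / N + (k + 1) / N := by ring
  rw [Complex.dist_eq, e]
  linarith

theorem discreteApprox_subset_erodedApprox (D : Set ℂ) (N : ℕ) :
    discreteApprox D N ⊆ erodedApprox D N :=
  originComponent_subset _

theorem unionOfSquares_mono (N : ℕ) {A B : Set (ℤ × ℤ)} (h : A ⊆ B) :
    unionOfSquares N A ⊆ unionOfSquares N B :=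
  interior_mono (biUnion_subset_biUnion_left h)

theorem unionOfSquares_erodedApprox_subset (D : Set ℂ) (N : ℕ) :
    unionOfSquares N (erodedApprox D N) ⊆ D :=
  interior_subset.trans (iUnion₂_subset fun _ hx => originComponent_subset _ hx.1)

theorem subset_unionOfSquares {K : Set ℂ} {N : ℕ} (hN : 0 < N) {A : Set (ℤ × ℤ)}
    (hA : ∀ z ∈ K, latticeBox 1 (latticeRound N z) ⊆ A) : K ⊆ unionOfSquares N A := by
  intro z hz
  refine mem_interior.2 ⟨Metric.ball z (1 / (2 * N)), fun w hw => ?_, Metric.isOpen_ball,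
    Metric.mem_ball_self (by positivity)⟩
  exact mem_iUnion₂.2 ⟨_, hA z hz (latticeRound_mem_latticeBox hN hw),
    mem_scaledSquare_latticeRound hN w⟩

theorem eventually_subset_of_isPreconnected {D K : Set ℂ} (hD : IsOpen D) (hK : IsCompact K)
    (hKD : K ⊆ D) (hKc : IsPreconnected K) (h0 : (0 : ℂ) ∈ K) :
    ∀ᶠ N in atTop, K ⊆ unionOfSquares N (discreteApprox D N) := by
  obtain ⟨δ, hδ, hδD⟩ := hK.exists_cthickening_subset_open hD hKD
  have hlim : Tendsto (fun N : ℕ => 2 * (((3 : ℕ) : ℝ) + 1) / N) atTop (𝓝 0) :=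
    tendsto_const_nhds.div_atTop tendsto_natCast_atTop_atTop
  filter_upwards [hlim.eventually (gt_mem_nhds hδ), eventually_gt_atTop 0] with N hNδ hN
  -- Radius 3 leaves room to spare: removing the inner boundary costs one layer, passing to a
  -- component costs none, and the final covering needs radius 1.
  have h1 : ∀ z ∈ K, latticeBox 3 (latticeRound N z) ⊆ squaresInside D N := by
    intro z hz y hy p hp
    exact hδD (Metric.mem_cthickening_of_dist_le p z δ K hz
      ((dist_le_of_mem_scaledSquare hN hy hp).trans hNδ.le))
  have h2 := latticeBox_latticeRound_subset_originComponent hKc h0 hN (by norm_num) h1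
  have h3 : ∀ z ∈ K, latticeBox 2 (latticeRound N z) ⊆ erodedApprox D N :=
    fun z hz => latticeBox_subset_diff_innerBoundary (h2 z hz)
  have h4 := latticeBox_latticeRound_subset_originComponent hKc h0 hN (by norm_num) h3
  exact subset_unionOfSquares hN fun z hz => (latticeBox_mono (by norm_num) _).trans (h4 z hz)

/-- Every compact subset of a plane domain lies in all but finitely many of its discrete
approximations. -/
theorem eventually_subset_unionOfSquares_discreteApprox {D K : Set ℂ} (hD : IsOpen D)
    (hDc : IsConnected D) (h0 : (0 : ℂ) ∈ D) (hK : IsCompact K) (hKD : K ⊆ D) :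
    ∀ᶠ N in atTop, K ⊆ unionOfSquares N (discreteApprox D N) := by
  refine hK.induction_on (p := fun s => ∀ᶠ N in atTop, s ⊆ unionOfSquares N (discreteApprox D N))
    (by simp) (fun s t hst ht => ht.mono fun N h => hst.trans h)
    (fun s t hs ht => (hs.and ht).mono fun N h => union_subset h.1 h.2) ?_
  intro z hz
  obtain ⟨γ, hγ⟩ := (hD.isConnected_iff_isPathConnected.1 hDc).joinedIn 0 h0 z (hKD hz)
  obtain ⟨ε, hε, hεD⟩ := Metric.nhds_basis_closedBall.mem_iff.1 (hD.mem_nhds (hKD hz))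
  refine ⟨Metric.closedBall z ε, mem_nhdsWithin_of_mem_nhds (Metric.closedBall_mem_nhds z hε), ?_⟩
  -- Adding a path from `0` to the ball makes the compact set connected through the origin.
  have key : ∀ᶠ N in atTop,
      range γ ∪ Metric.closedBall z ε ⊆ unionOfSquares N (discreteApprox D N) := by
    refine eventually_subset_of_isPreconnected hD
      ((isCompact_range γ.continuous).union (isCompact_closedBall z ε))
      (union_subset (range_subset_iff.2 hγ) hεD) ?_ (Or.inl ⟨0, γ.source⟩)
    exact IsPreconnected.union z ⟨1, γ.target⟩ (Metric.mem_closedBall_self hε.le)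
      (isPreconnected_range γ.continuous) (convex_closedBall z ε).isPreconnected
  exact key.mono fun N h => subset_union_right.trans h

/-! ### Convergence of domains exhausting a domain from inside -/

theorem caratheodoryConverges_of_subset {U : ℕ → Set ℂ} {D : Set ℂ} (hD : IsOpen D)
    (hDc : IsConnected D) (h0 : (0 : ℂ) ∈ D) (hU : ∀ n, U n ⊆ D)
    (hK : ∀ K : Set ℂ, IsCompact K → K ⊆ D → ∀ᶠ n in atTop, K ⊆ U n) :
    CaratheodoryConverges U D := by
  intro φ hφ
  refine ⟨⟨hD, hDc, h0, fun K hKc hKD => hφ.tendsto_atTop.eventually (hK K hKc hKD)⟩, ?_⟩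
  rintro E ⟨-, -, -, hE⟩ z hz
  obtain ⟨n, hn⟩ := (hE {z} isCompact_singleton (singleton_subset_iff.2 hz)).exists
  exact hU _ (hn rfl)

/-! ### Inverses of injective holomorphic maps, and lifting -/

/-- The inverse of an injective holomorphic function on an open set is holomorphic. -/
theorem differentiableOn_invFunOn {f : ℂ → ℂ} {s : Set ℂ} (hs : IsOpen s)
    (hf : DifferentiableOn ℂ f s) (hinj : InjOn f s) :
    DifferentiableOn ℂ (Function.invFunOn f s) (f '' s) := by
  have hleft : ∀ z ∈ s, Function.invFunOn f s (f z) = z := hinj.leftInvOn_invFunOn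
  have hnonconst : ∀ z ∈ s, ¬ ∀ᶠ w in 𝓝 z, f w = f z := by
    intro z hz h
    have h1 : ∀ᶠ w in 𝓝[≠] z, False := by
      filter_upwards [mem_nhdsWithin_of_mem_nhds h, mem_nhdsWithin_of_mem_nhds (hs.mem_nhds hz),
        self_mem_nhdsWithin] with w hw hws hne
      exact hne (hinj hws hz hw)
    exact h1.exists.elim fun _ h => h
  have hana : ∀ z ∈ s, AnalyticAt ℂ f z := fun z hz => hf.analyticAt (hs.mem_nhds hz)
  -- The open mapping theorem makes the inverse continuous. Critical points are isolated, so their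
  -- images are removable singularities of the inverse.
  have hmap : ∀ z ∈ s, 𝓝 (f z) ≤ map f (𝓝 z) := fun z hz =>
    (hana z hz).eventually_constant_or_nhds_le_map_nhds.resolve_left (hnonconst z hz)
  have hcont : ∀ z ∈ s, ContinuousAt (Function.invFunOn f s) (f z) := by
    intro z hz
    rw [ContinuousAt, hleft z hz]
    refine Tendsto.mono_left ?_ (hmap z hz)
    rw [tendsto_map'_iff]
    refine tendsto_id.congr' ?_
    filter_upwards [hs.mem_nhds hz] with w hw
    exact (hleft w hw).symm
  have hderiv : ∀ z ∈ s, deriv f z ≠ 0 →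
      DifferentiableAt ℂ (Function.invFunOn f s) (f z) := by
    intro z hz hne
    refine (HasDerivAt.of_local_left_inverse (f := f) (f' := deriv f z) (hcont z hz) ?_ hne
      ?_).differentiableAt
    · rw [hleft z hz]
      exact (hf.differentiableAt (hs.mem_nhds hz)).hasDerivAt
    · filter_upwards [hmap z hz (image_mem_map (hs.mem_nhds hz))] with w hw
      exact Function.invFunOn_eq hw
  rintro _ ⟨z, hz, rfl⟩
  refine DifferentiableAt.differentiableWithinAt (AnalyticAt.differentiableAt ?_)
  refine Complex.analyticAt_of_differentiable_on_punctured_nhds_of_continuousAt ?_ (hcont z hz)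
  have hne : ∀ᶠ w in 𝓝[≠] z, deriv f w ≠ 0 := by
    refine (hana z hz).deriv.eventually_eq_zero_or_eventually_ne_zero.resolve_left fun h => ?_
    obtain ⟨ε, hε, hball⟩ := Metric.mem_nhds_iff.1 (inter_mem h (hs.mem_nhds hz))
    refine hnonconst z hz ?_
    filter_upwards [Metric.ball_mem_nhds z hε] with w hw
    exact Metric.isOpen_ball.is_const_of_deriv_eq_zero (convex_ball z ε).isPreconnected
      (hf.mono fun x hx => (hball hx).2) (fun x hx => (hball hx).1) hw (Metric.mem_ball_self hε)
  have hgood : {w | w ∈ s ∧ (w ≠ z → deriv f w ≠ 0)} ∈ 𝓝 z :=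
    inter_mem (hs.mem_nhds hz) (eventually_nhdsWithin_iff.1 hne)
  filter_upwards [mem_nhdsWithin_of_mem_nhds (hmap z hz (image_mem_map hgood)),
    self_mem_nhdsWithin] with w hw hwz
  obtain ⟨x, ⟨hxs, hx⟩, rfl⟩ := hw
  exact hderiv x hxs (hx fun h => hwz (h ▸ rfl))

theorem exists_holomorphic_lift {f g : ℂ → ℂ} {s t : Set ℂ} (hs : IsOpen s)
    (hf : DifferentiableOn ℂ f s) (hinj : InjOn f s) (hg : DifferentiableOn ℂ g t)
    (hgf : MapsTo g t (f '' s)) :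
    ∃ h : ℂ → ℂ, DifferentiableOn ℂ h t ∧ MapsTo h t s ∧ ∀ z ∈ t, f (h z) = g z :=
  ⟨Function.invFunOn f s ∘ g, (differentiableOn_invFunOn hs hf hinj).comp hg hgf,
    fun _ hz => Function.invFunOn_mem (hgf hz), fun _ hz => Function.invFunOn_eq (hgf hz)⟩

/-! ### Quantitative Schwarz lemma and convergence of Riemann maps -/

/-- A holomorphic self-map of the disk fixing the origin, with derivative close to `1` there, is
close to the identity. -/
theorem norm_sub_self_le_of_norm_deriv_sub_one_le {ω : ℂ → ℂ}
    (hd : DifferentiableOn ℂ ω (Metric.ball 0 1))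
    (hm : MapsTo ω (Metric.ball 0 1) (Metric.ball 0 1)) (h0 : ω 0 = 0) {ε : ℝ} (hε : 0 < ε)
    (hderiv : ‖deriv ω 0 - 1‖ ≤ ε) {z : ℂ} (hz : z ∈ Metric.ball (0 : ℂ) 1) :
    ‖ω z - z‖ ≤ 4 * ε / (1 - ‖z‖) := by
  have hz1 : ‖z‖ < 1 := mem_ball_zero_iff.1 hz
  have hm' : MapsTo ω (Metric.ball 0 1) (Metric.closedBall (ω 0) 1) := by
    rw [h0]
    exact hm.mono_right Metric.ball_subset_closedBall
  have hds : DifferentiableOn ℂ (fun w => dslope ω 0 w - 1) (Metric.ball 0 1) :=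
    ((Complex.differentiableOn_dslope (Metric.ball_mem_nhds 0 one_pos)).2 hd).sub_const 1
  -- By Schwarz `‖dslope ω 0 w‖ ≤ 1`, so the real part is even `≤ 0`; Borel–Carathéodory needs a
  -- positive bound.
  have hre : MapsTo (fun w => dslope ω 0 w - 1) (Metric.ball 0 1) {w | w.re ≤ ε} := by
    intro w hw
    have h1 := Complex.norm_dslope_le_div_of_mapsTo_ball hd hm' hw
    have h2 := Complex.re_le_norm (dslope ω 0 w)
    simp only [mem_ofPred_eq, Complex.sub_re, Complex.one_re]
    linarith
  have h1 := Complex.borelCaratheodory hε hds hre one_pos hz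
  simp only [dslope_same] at h1
  have hωz : ω z - z = z * (dslope ω 0 z - 1) := by
    have := sub_smul_dslope ω 0 z
    rw [h0, sub_zero, sub_zero, smul_eq_mul] at this
    rw [mul_sub, this, mul_one]
  have hpos : 0 < 1 - ‖z‖ := by linarith
  have h2 : ‖dslope ω 0 z - 1‖ ≤ 4 * ε / (1 - ‖z‖) := by
    refine h1.trans ?_
    rw [← add_div]
    gcongr
    nlinarith [norm_nonneg z, norm_nonneg (deriv ω 0 - 1)]
  rw [hωz, norm_mul]
  exact (mul_le_of_le_one_left (norm_nonneg _) hz1.le).trans h2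

theorem IsNormalizedRiemannMap.deriv_eq_re {f : ℂ → ℂ} {U : Set ℂ}
    (hf : IsNormalizedRiemannMap f U) : deriv f 0 = ((deriv f 0).re : ℂ) :=
  Complex.ext rfl (by simp [hf.deriv_im_eq_zero])

theorem IsNormalizedRiemannMap.hasDerivAt_zero {f : ℂ → ℂ} {U : Set ℂ}
    (hf : IsNormalizedRiemannMap f U) : HasDerivAt f (deriv f 0) 0 :=
  (hf.differentiableOn.differentiableAt (Metric.ball_mem_nhds 0 one_pos)).hasDerivAt

/-- If `U ⊆ D` contains the image under the Riemann map `f` of `D` of the disk of radius `r`, then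
the Riemann map of `U` is `f ∘ ω` for a self-map `ω` of the disk with `r ≤ ω' 0 ≤ 1`. -/
theorem IsNormalizedRiemannMap.exists_lift {f g : ℂ → ℂ} {D U : Set ℂ}
    (hf : IsNormalizedRiemannMap f D) (hg : IsNormalizedRiemannMap g U) (hUD : U ⊆ D) {r : ℝ}
    (hr : 0 < r) (hr1 : r < 1) (hrU : f '' Metric.ball 0 r ⊆ U) :
    ∃ ω : ℂ → ℂ, DifferentiableOn ℂ ω (Metric.ball 0 1) ∧
      MapsTo ω (Metric.ball 0 1) (Metric.ball 0 1) ∧ ω 0 = 0 ∧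
      (∀ z ∈ Metric.ball (0 : ℂ) 1, f (ω z) = g z) ∧ ‖deriv ω 0 - 1‖ ≤ 1 - r := by
  have h0 : (0 : ℂ) ∈ Metric.ball (0 : ℂ) 1 := Metric.mem_ball_self one_pos
  have hnhds : Metric.ball (0 : ℂ) 1 ∈ 𝓝 0 := Metric.ball_mem_nhds 0 one_pos
  have hsmul : ∀ z ∈ Metric.ball (0 : ℂ) 1, (r : ℂ) * z ∈ Metric.ball (0 : ℂ) r := by
    intro z hz
    rw [mem_ball_zero_iff] at hz ⊢
    rw [norm_mul, Complex.norm_real, Real.norm_of_nonneg hr.le]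
    nlinarith
  have hsub : Metric.ball (0 : ℂ) r ⊆ Metric.ball 0 1 := Metric.ball_subset_ball hr1.le
  obtain ⟨ω, hωd, hωm, hω⟩ := exists_holomorphic_lift Metric.isOpen_ball hf.differentiableOn
    hf.injOn hg.differentiableOn (t := Metric.ball 0 1) (by
      rw [hf.image_eq]
      exact (mapsTo_iff_image_subset.2 hg.image_eq.subset).mono_right hUD)
  -- `h` lifts `f (r z)` through `g`. Then `ω (h z) = r z`, and Schwarz for `h` gives `r ≤ ‖ω' 0‖`.
  obtain ⟨h, hhd, hhm, hh⟩ := exists_holomorphic_lift (g := fun z => f (r * z))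
    (t := Metric.ball 0 1) Metric.isOpen_ball hg.differentiableOn hg.injOn
    (hf.differentiableOn.comp (by fun_prop) fun z hz => hsub (hsmul z hz)) (by
      rw [hg.image_eq]
      exact fun z hz => hrU (mem_image_of_mem f (hsmul z hz)))
  have hω0 : ω 0 = 0 :=
    hf.injOn (hωm h0) h0 (by rw [hω 0 h0, hf.map_zero, hg.map_zero])
  have hh0 : h 0 = 0 :=
    hg.injOn (hhm h0) h0 (by rw [hh 0 h0, mul_zero, hf.map_zero, hg.map_zero])
  have hωh : ∀ z ∈ Metric.ball (0 : ℂ) 1, ω (h z) = r * z := fun z hz =>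
    hf.injOn (hωm (hhm hz)) (hsub (hsmul z hz)) (by rw [hω _ (hhm hz), hh z hz])
  have dω : HasDerivAt ω (deriv ω 0) 0 := (hωd.differentiableAt hnhds).hasDerivAt
  have dh : HasDerivAt h (deriv h 0) 0 := (hhd.differentiableAt hnhds).hasDerivAt
  have e1 : deriv f 0 * deriv ω 0 = deriv g 0 := by
    have h1 : HasDerivAt (f ∘ ω) (deriv f 0 * deriv ω 0) 0 :=
      HasDerivAt.comp 0 (by rw [hω0]; exact hf.hasDerivAt_zero) dω
    refine h1.unique (hg.hasDerivAt_zero.congr_of_eventuallyEq ?_)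
    filter_upwards [hnhds] with z hz using hω z hz
  have e2 : deriv ω 0 * deriv h 0 = r := by
    have h1 : HasDerivAt (ω ∘ h) (deriv ω 0 * deriv h 0) 0 :=
      HasDerivAt.comp 0 (by rw [hh0]; exact dω) dh
    have h2 : HasDerivAt (fun z : ℂ => (r : ℂ) * z) r 0 := by
      simpa using (hasDerivAt_id (0 : ℂ)).const_mul (r : ℂ)
    refine h1.unique (h2.congr_of_eventuallyEq ?_)
    filter_upwards [hnhds] with z hz using hωh z hz
  have n1 : ‖deriv ω 0‖ ≤ 1 := Complex.norm_deriv_le_one_of_mapsTo_ball hωd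
    (by rw [hω0]; exact hωm.mono_right Metric.ball_subset_closedBall) one_pos
  have n2 : ‖deriv h 0‖ ≤ 1 := Complex.norm_deriv_le_one_of_mapsTo_ball hhd
    (by rw [hh0]; exact hhm.mono_right Metric.ball_subset_closedBall) one_pos
  have hfpos := hf.deriv_re_pos
  have hgpos := hg.deriv_re_pos
  obtain ⟨a, ha0, ha⟩ : ∃ a : ℝ, 0 < a ∧ deriv ω 0 = a := by
    refine ⟨(deriv g 0).re / (deriv f 0).re, by positivity, ?_⟩
    rw [Complex.ofReal_div, ← hf.deriv_eq_re, ← hg.deriv_eq_re, ← e1, mul_div_cancel_left₀]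
    rw [hf.deriv_eq_re]
    exact_mod_cast hfpos.ne'
  have hna : ‖deriv ω 0‖ = a := by rw [ha, Complex.norm_real, Real.norm_of_nonneg ha0.le]
  have hra : r ≤ a := by
    have := congrArg norm e2
    rw [norm_mul, hna, Complex.norm_real, Real.norm_of_nonneg hr.le] at this
    nlinarith
  refine ⟨ω, hωd, hωm, hω0, hω, ?_⟩
  have e3 : deriv ω 0 - 1 = ((a - 1 : ℝ) : ℂ) := by rw [ha]; push_cast; rfl
  rw [hna] at n1
  rw [e3, Complex.norm_real, Real.norm_eq_abs, abs_le]
  constructor <;> linarith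

/-- Riemann maps of domains exhausting `D` from inside converge to the Riemann map of `D`. -/
theorem tendstoUniformlyOn_riemannMap_of_subset {U : ℕ → Set ℂ} {D : Set ℂ}
    (hU : ∀ n, U n ⊆ D)
    (hK : ∀ K : Set ℂ, IsCompact K → K ⊆ D → ∀ᶠ n in atTop, K ⊆ U n)
    {f : ℂ → ℂ} {F : ℕ → ℂ → ℂ} {S : Set ℕ} (hf : IsNormalizedRiemannMap f D)
    (hF : ∀ n ∈ S, IsNormalizedRiemannMap (F n) (U n)) {K : Set ℂ} (hKc : IsCompact K)
    (hKb : K ⊆ Metric.ball 0 1) : TendstoUniformlyOn F f (atTop ⊓ 𝓟 S) K := by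
  obtain ⟨ρ, hρ1, hKρ⟩ := exists_lt_subset_ball hKc.isClosed hKb
  have hcont : ∀ {s : ℝ}, s < 1 → ContinuousOn f (Metric.closedBall 0 s) := fun hs =>
    hf.differentiableOn.continuousOn.mono (Metric.closedBall_subset_ball hs)
  have huc : UniformContinuousOn f (Metric.closedBall 0 ρ) :=
    (isCompact_closedBall (0 : ℂ) ρ).uniformContinuousOn_of_continuous (hcont hρ1)
  rw [Metric.tendstoUniformlyOn_iff]
  intro ε hε
  obtain ⟨δ, hδ, huc⟩ := Metric.uniformContinuousOn_iff.1 huc ε hε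
  have hρ' : 0 < 1 - ρ := by linarith
  -- Chosen so that `4 η / (1 - ρ) < δ`.
  obtain ⟨η, hη0, hη⟩ : ∃ η : ℝ, 0 < η ∧ η < min 1 (δ * (1 - ρ) / 4) :=
    exists_between (by positivity)
  have hη1 : η < 1 := hη.trans_le (min_le_left _ _)
  have hηδ : η < δ * (1 - ρ) / 4 := hη.trans_le (min_le_right _ _)
  have hev := hK (f '' Metric.closedBall 0 (1 - η))
    ((isCompact_closedBall (0 : ℂ) (1 - η)).image_of_continuousOn (hcont (by linarith)))
    ((image_mono (Metric.closedBall_subset_ball (by linarith))).trans hf.image_eq.subset)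
  rw [eventually_inf_principal]
  filter_upwards [hev] with n hn hnS z hz
  obtain ⟨ω, hωd, hωm, hω0, hω, hω1⟩ := hf.exists_lift (hF n hnS) (hU n) (r := 1 - η)
    (by linarith) (by linarith) ((image_mono Metric.ball_subset_closedBall).trans hn)
  rw [sub_sub_cancel] at hω1
  have hzρ : ‖z‖ < ρ := mem_ball_zero_iff.1 (hKρ hz)
  have hωz : ‖ω z‖ ≤ ‖z‖ := Complex.norm_le_norm_of_mapsTo_ball hωd
    (hωm.mono_right Metric.ball_subset_closedBall) hω0 (by linarith)
  have hclose := norm_sub_self_le_of_norm_deriv_sub_one_le hωd hωm hω0 hη0 hω1 (hKb hz)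
  rw [← hω z (hKb hz)]
  refine huc z (by simpa using hzρ.le) (ω z) (by simpa using hωz.trans hzρ.le) ?_
  rw [dist_comm, dist_eq_norm]
  refine hclose.trans_lt ?_
  rw [div_lt_iff₀ (by linarith)]
  nlinarith

theorem theorem1p2 (D : Set ℂ) (hD : IsJordanDomain D) (h0 : (0 : ℂ) ∈ D)
    (hinrad : Metric.infDist 0 (frontier D) = 1) :
    -- the union-of-squares domains of the connected approximations
    (CaratheodoryConverges (fun N => unionOfSquares N (discreteApprox D N)) D ∧
      ∀ (f : ℂ → ℂ) (F : ℕ → ℂ → ℂ) (S : Set ℕ), IsNormalizedRiemannMap f D →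
        (∀ N ∈ S, IsNormalizedRiemannMap (F N) (unionOfSquares N (discreteApprox D N))) →
        ∀ K : Set ℂ, IsCompact K → K ⊆ Metric.ball 0 1 →
          TendstoUniformlyOn F f (atTop ⊓ 𝓟 S) K) ∧
    -- the same without passing to the component of the origin
    (CaratheodoryConverges (fun N => unionOfSquares N (erodedApprox D N)) D ∧
      ∀ (f : ℂ → ℂ) (F : ℕ → ℂ → ℂ) (S : Set ℕ), IsNormalizedRiemannMap f D →
        (∀ N ∈ S, IsNormalizedRiemannMap (F N) (unionOfSquares N (erodedApprox D N))) →
        ∀ K : Set ℂ, IsCompact K → K ⊆ Metric.ball 0 1 →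
          TendstoUniformlyOn F f (atTop ⊓ 𝓟 S) K) := by
  have hK (K : Set ℂ) (hKc : IsCompact K) (hKD : K ⊆ D) :=
    eventually_subset_unionOfSquares_discreteApprox hD.isOpen hD.isConnected h0 hKc hKD
  have hmono (N : ℕ) := unionOfSquares_mono N (discreteApprox_subset_erodedApprox D N)
  have hK' (K : Set ℂ) (hKc : IsCompact K) (hKD : K ⊆ D) :
      ∀ᶠ N in atTop, K ⊆ unionOfSquares N (erodedApprox D N) :=
    (hK K hKc hKD).mono fun N h => h.trans (hmono N)
  have hU' := unionOfSquares_erodedApprox_subset D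
  have hU (N : ℕ) := (hmono N).trans (hU' N)
  exact ⟨⟨caratheodoryConverges_of_subset hD.isOpen hD.isConnected h0 hU hK,
      fun _ _ _ hf hF _ hKc hKb => tendstoUniformlyOn_riemannMap_of_subset hU hK hf hF hKc hKb⟩,
    caratheodoryConverges_of_subset hD.isOpen hD.isConnected h0 hU' hK',
    fun _ _ _ hf hF _ hKc hKb => tendstoUniformlyOn_riemannMap_of_subset hU' hK' hf hF hKc hKb⟩
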